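/- **Theorem 4.1.** Let $A$ be a (not necessarily unital) $C^*$-algebra and let $P:A\to A$ be a completely positive contraction, i.e. a completely positive linear map with $\|P\|\le 1$. Assume that $P$ is locally finite: for every $a\in A$ the norm closure of the orbit $\{a,P(a),P^2(a),\dots\}$ is compact. A *quasiautomorphism* of $A$ is a completely positive contraction $Q:A\to A$ that admits a factorization $Q=\alpha\circ E$, where $E:A\to A$ is an idempotent completely positive contraction and $\alpha$ is a completely isometric linear map of $E(A)$ onto itself (that is, for every $n$ the entrywise map $(x_{ij})\mapsto(\alpha(x_{ij}))$ is isometric on $M_n(E(A))\subseteq M_n(A)$). Then there is a unique quasiautomorphism $Q$ of $A$ such that $$\lim_{n\to\infty}\|P^n(a)-Q^n(a)\|=0,\qquad a\in A.$$ Moreover, in every factorization $Q=\alpha\circ E$ as above: 1. $E$ is the unique idempotent in the set $$\bigcap_{n\ge 1}\overline{\{P^n,P^{n+1},P^{n+2},\dots\}}$$ of strong cluster points of the powers of $P$, the closures being taken in the topology of pointwise norm convergence on the bounded operators on $A$; 2. $\alpha$ is the restriction of $P$ to $E(A)$ (in particular this restriction is a complete isometry of $E(A)$ onto itself); 3. $E(A)$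 is the norm-closed linear span of the maximal eigenvectors of $P$, i.e. of the nonzero $a\in A$ with $P(a)=\lambda a$ for some $\lambda\in\mathbb C$ with $|\lambda|=1$. In particular $E$ and $\alpha$ are uniquely determined by $P$. -/

import Mathlib

open Filter Topology
open scoped CStarAlgebra

noncomputable section

namespace CPDynamics

variable {A : Type*} [NonUnitalCStarAlgebra A] [PartialOrder A] [StarOrderedRing A]

/-- A completely positive contraction `P : A → A`: a bounded linear map that is completely positive
(in the sense of Mathlib's `CompletelyPositiveMap`) and has operator norm at most one. -/
structure IsCPContraction (P : A →L[ℂ] A) : Prop where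
  completelyPositive : ∃ φ : A →CP A, ∀ a, φ a = P a
  norm_le_one : ‖P‖ ≤ 1

/-- `T` is locally finite: the norm-closure of the orbit `{a, T a, T² a, …}` of every vector `a`
is compact. -/
def IsLocallyFinite {X : Type*} [NormedAddCommGroup X] [NormedSpace ℂ X] (T : X →L[ℂ] X) : Prop :=
  ∀ x : X, IsCompact (closure (Set.range fun n : ℕ => (T ^ n) x))

/-- A maximal eigenvector: a (nonzero) eigenvector whose eigenvalue has absolute value one. -/
def IsMaximalEigenvector {X : Type*} [NormedAddCommGroup X] [NormedSpace ℂ X]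
    (T : X →L[ℂ] X) (x : X) : Prop :=
  ∃ c : ℂ, ‖c‖ = 1 ∧ Module.End.HasEigenvector (T : X →ₗ[ℂ] X) c x

/-- The set `⋂ₙ {Tⁿ, Tⁿ⁺¹, Tⁿ⁺², …}⁻`, `n ≥ 1`, of strong cluster points of the powers of `T`, the
closures being taken in the topology of pointwise norm convergence. -/
def strongClusterPoints {X : Type*} [NormedAddCommGroup X] [NormedSpace ℂ X]
    (T : X →L[ℂ] X) : Set (X →L[ℂ] X) :=
  {L | ∀ n : ℕ, 1 ≤ n →
    ContinuousLinearMap.toPointwiseConvergenceCLM ℂ (RingHom.id ℂ) X X L ∈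
      closure {S | ∃ k : ℕ, n ≤ k ∧
        S = ContinuousLinearMap.toPointwiseConvergenceCLM ℂ (RingHom.id ℂ) X X (T ^ k)}}

/-- A linear map `u : V → V` of a linear subspace `V ⊆ A` is completely isometric: for every `n`,
the entrywise map `M_n(V) → M_n(V)` preserves the norm that `M_n(V)` inherits from the
C⋆-algebra `M_n(A)`. -/
def IsCompletelyIsometric (V : Submodule ℂ A) (u : V →ₗ[ℂ] V) : Prop :=
  ∀ (n : ℕ) (M : CStarMatrix (Fin n) (Fin n) V),
    ‖M.map (fun v => ((u v : V) : A))‖ = ‖M.map (fun v => (v : A))‖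

/-- `Q = α ∘ E`, where `E` is an idempotent completely positive contraction on `A` and `α` is a
completely isometric linear map of `E(A)` onto itself. -/
structure IsFactorization (Q E : A →L[ℂ] A)
    (α : (E : A →ₗ[ℂ] A).range →ₗ[ℂ] (E : A →ₗ[ℂ] A).range) : Prop where
  isCPContraction : IsCPContraction E
  isIdempotent : IsIdempotentElem E
  isometric : IsCompletelyIsometric (E : A →ₗ[ℂ] A).range α
  surjective : Function.Surjective α
  eq_comp : ∀ a : A, Q a = α ((E : A →ₗ[ℂ] A).rangeRestrict a)

/-- A quasiautomorphism of `A` (in the category of completely positive maps): a completely positive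
contraction that has a factorization `Q = α ∘ E` as above. -/
def IsQuasiautomorphism (Q : A →L[ℂ] A) : Prop :=
  IsCPContraction Q ∧
    ∃ (E : A →L[ℂ] A) (α : (E : A →ₗ[ℂ] A).range →ₗ[ℂ] (E : A →ₗ[ℂ] A).range),
      IsFactorization Q E α

end CPDynamics

end

/-! Let `U` be an ultrafilter on `ℕ` tending to infinity and idempotent for addition. Orbits are
relatively compact, so `P ^ n` converges pointwise along `U` to a contraction `E`. It commutes with
`P` and is idempotent because `U` is.

Since `n ↦ ‖(P ^ n) a‖` is antitone, its behaviour along `U` decides its behaviour at infinity: the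
powers tend to zero on the kernel of `E` and are isometric on the range. Hence `Q = P * E` works, as
`Q ^ n = P ^ n * E` for `n ≥ 1`. Complete positivity passes to pointwise limits. Completely positive
contractions are completely contractive, so recurrence along `U` makes `P` completely isometric on
`E(A)`.

Uniqueness rests on one trick: an idempotent that maps a subspace isometrically into itself is the
identity there. It is applied to `E` on the range of a competing factorization, and to a competing
idempotent cluster point on the range of `E`.

For the eigenvectors, suppose a functional `φ` kills them all but not some `x` in `E(A)`. The orbit
of `x` returns near itself so often that, by a finite Fourier argument, averages of `z ^ n • (P ^ n)
x` with suitable unimodular `z` keep `φ` away from zero. A limit of such averages is a maximal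
eigenvector on which `φ` is nonzero, a contradiction. -/

namespace CPDynamics

/-! ### Order estimates in a C⋆-algebra. -/

section Positivity

variable {B : Type*} [NonUnitalCStarAlgebra B] [PartialOrder B] [StarOrderedRing B]

lemma exists_eq_star_mul_self {b : B} (hb : 0 ≤ b) : ∃ s, b = star s * s :=
  CStarAlgebra.nonneg_iff_eq_star_mul_self.mp hb

lemma star_mul_contraction_mul_le {e x : B} (hx : ‖x‖ ≤ 1) :
    star e * (star x * x) * e ≤ star e * e := by
  refine (CStarAlgebra.star_left_conjugate_le_norm_smul (IsSelfAdjoint.star_mul_self x)).trans ?_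
  have : ‖star x * x‖ ≤ 1 := by
    rw [CStarRing.norm_star_mul_self]
    exact mul_le_one₀ hx (norm_nonneg _) hx
  calc ‖star x * x‖ • (star e * e) ≤ (1 : ℝ) • (star e * e) :=
        smul_le_smul_of_nonneg_right this (star_mul_self_nonneg e)
    _ = _ := one_smul _ _

end Positivity

/-! ### Block matrices: positivity against the norm of a corner. -/

section BlockMatrices

variable {n A : Type*}

/-- The `2 × 2` block matrix with the given square blocks. -/
def blocks (a b c d : CStarMatrix n n A) : CStarMatrix (n ⊕ n) (n ⊕ n) A :=
  CStarMatrix.ofMatrix (Matrix.fromBlocks a b c d)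

lemma blocks_map {B : Type*} (f : A → B) (a b c d : CStarMatrix n n A) :
    (blocks a b c d).map f = blocks (a.map f) (b.map f) (c.map f) (d.map f) := by
  ext (i | i) (j | j) <;> rfl

lemma exists_eq_blocks (M : CStarMatrix (n ⊕ n) (n ⊕ n) A) : ∃ a b c d, M = blocks a b c d :=
  ⟨Matrix.toBlocks₁₁ M, Matrix.toBlocks₁₂ M, Matrix.toBlocks₂₁ M, Matrix.toBlocks₂₂ M,
    (Matrix.fromBlocks_toBlocks M).symm⟩

lemma blocks_inj {a b c d a' b' c' d' : CStarMatrix n n A}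
    (h : blocks a b c d = blocks a' b' c' d') : a = a' ∧ b = b' ∧ c = c' ∧ d = d' :=
  Matrix.fromBlocks_inj.mp h

variable [NonUnitalCStarAlgebra A]

lemma blocks_mul [Fintype n] (a b c d a' b' c' d' : CStarMatrix n n A) :
    blocks a b c d * blocks a' b' c' d' =
      blocks (a * a' + b * c') (a * b' + b * d') (c * a' + d * c') (c * b' + d * d') :=
  congrArg CStarMatrix.ofMatrix (Matrix.fromBlocks_multiply a b c d a' b' c' d')

lemma star_blocks (a b c d : CStarMatrix n n A) :
    star (blocks a b c d) = blocks (star a) (star c) (star b) (star d) :=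
  congrArg CStarMatrix.ofMatrix (Matrix.fromBlocks_conjTranspose a b c d)

lemma blocks_add (a b c d a' b' c' d' : CStarMatrix n n A) :
    blocks a b c d + blocks a' b' c' d' = blocks (a + a') (b + b') (c + c') (d + d') :=
  congrArg CStarMatrix.ofMatrix (Matrix.fromBlocks_add a b c d a' b' c' d')

variable [Fintype n]

/-- The corner embedding into block matrices. -/
def cornerHom : CStarMatrix n n A →⋆ₙₐ[ℂ] CStarMatrix (n ⊕ n) (n ⊕ n) A where
  toFun a := blocks a 0 0 0
  map_smul' c a := by
    ext (i | i) (j | j)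
    exacts [rfl, (smul_zero c).symm, (smul_zero c).symm, (smul_zero c).symm]
  map_zero' := by ext (i | i) (j | j) <;> rfl
  map_add' a b := by simp [blocks_add]
  map_mul' a b := by simp [blocks_mul]
  map_star' a := by simp [star_blocks]

lemma cornerHom_injective : Function.Injective (cornerHom (n := n) (A := A)) :=
  fun _ _ h => (blocks_inj h).1

/-- The embedding of `A` into matrices over `A` as scalar matrices. -/
def scalarHom [DecidableEq n] : A →⋆ₙₐ[ℂ] CStarMatrix n n A where
  toFun a := CStarMatrix.ofMatrix (Matrix.diagonal fun _ => a)
  map_smul' c a := by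
    ext i j
    by_cases h : i = j <;> simp [Matrix.diagonal, h]
  map_zero' := by
    ext i j
    by_cases h : i = j <;> simp [Matrix.diagonal, h]
  map_add' a b := by
    ext i j
    by_cases h : i = j <;> simp [Matrix.diagonal, h]
  map_mul' a b := congrArg CStarMatrix.ofMatrix
    (Matrix.diagonal_mul_diagonal (fun _ : n => a) (fun _ => b)).symm
  map_star' a := congrArg CStarMatrix.ofMatrix
    (Matrix.diagonal_conjTranspose (fun _ : n => a)).symm

lemma scalarHom_mul_mul_apply [DecidableEq n] (a b : A) (M : CStarMatrix n n A) (i j : n) :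
    ((scalarHom (n := n) a * M * scalarHom (n := n) b : CStarMatrix n n A)) i j = a * M i j * b := by
  exact (Matrix.mul_diagonal (fun _ => b)
    (Matrix.diagonal (fun _ => a) * CStarMatrix.ofMatrix.symm M) i j).trans
    (congrArg (· * b) (Matrix.diagonal_mul (fun _ => a) (CStarMatrix.ofMatrix.symm M) i j))

lemma scalarHom_map [DecidableEq n] (f : A →ₗ[ℂ] A) (a : A) :
    (scalarHom (n := n) a).map f = scalarHom (f a) := by
  ext i j
  change f (Matrix.diagonal (fun _ => a) i j) = Matrix.diagonal (fun _ => f a) i j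
  by_cases h : i = j <;> simp [Matrix.diagonal, h]

variable [PartialOrder A] [StarOrderedRing A]

lemma norm_corner (a : CStarMatrix n n A) : ‖blocks a 0 0 0‖ = ‖a‖ :=
  NonUnitalStarAlgHom.norm_map (cornerHom (n := n) (A := A)) cornerHom_injective a

/-- Writing the matrix as `star S * S`, `x` is the product of the two block columns of `S`, whose
squared norms are `‖p‖` and `‖q‖`: a Cauchy–Schwarz estimate. -/
lemma norm_off_diagonal_le_one {p x y q : CStarMatrix n n A} (h : 0 ≤ blocks p x y q)
    (hp : ‖p‖ ≤ 1) (hq : ‖q‖ ≤ 1) : ‖x‖ ≤ 1 := by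
  obtain ⟨S, hS⟩ := exists_eq_star_mul_self h
  obtain ⟨a, b, c, d, rfl⟩ := exists_eq_blocks S
  rw [star_blocks, blocks_mul] at hS
  obtain ⟨h1, h2, -, h4⟩ := blocks_inj hS
  have key (u v w z : CStarMatrix n n A) : star (blocks u 0 v 0) * blocks w 0 z 0 =
      blocks (star u * w + star v * z) 0 0 0 := by
    rw [star_blocks, blocks_mul]; simp
  have hleft : ‖blocks a 0 c 0‖ ≤ 1 := by
    rw [← sq_le_one_iff₀ (norm_nonneg _), sq, ← CStarRing.norm_star_mul_self, key, ← h1,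
      norm_corner]
    exact hp
  have hright : ‖blocks b 0 d 0‖ ≤ 1 := by
    rw [← sq_le_one_iff₀ (norm_nonneg _), sq, ← CStarRing.norm_star_mul_self, key, ← h4,
      norm_corner]
    exact hq
  calc ‖x‖ = ‖star (blocks a 0 c 0) * blocks b 0 d 0‖ := by rw [key, ← h2, norm_corner]
    _ ≤ ‖star (blocks a 0 c 0)‖ * ‖blocks b 0 d 0‖ := norm_mul_le _ _
    _ ≤ 1 * 1 := by
      rw [norm_star]
      gcongr
    _ = 1 := one_mul 1

/-- A substitute, without a unit, for the positivity of the block matrix with diagonal `1` and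
corner `x`. It is the square of the row `(e, x * e)` plus the defect `star s * s` in the last
corner. -/
lemma blocks_nonneg_of_norm_le_one {e x : CStarMatrix n n A} (hx : ‖x‖ ≤ 1) :
    0 ≤ blocks (star e * e) (star e * x * e) (star (star e * x * e)) (star e * e) := by
  obtain ⟨s, hs⟩ := exists_eq_star_mul_self (sub_nonneg.mpr (star_mul_contraction_mul_le (e := e) hx))
  have h2 : blocks (star e * e) (star e * x * e) (star (star e * x * e)) (star e * e) =
      star (blocks e (x * e) 0 0) * blocks e (x * e) 0 0 + star (blocks 0 0 0 s) *
        blocks 0 0 0 s := by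
    rw [star_blocks, star_blocks, blocks_mul, blocks_mul, blocks_add]
    simp only [star_zero, mul_zero, zero_mul, add_zero, zero_add, ← hs, star_mul, star_star]
    congr 1
    · noncomm_ring
    · noncomm_ring
    · noncomm_ring
  rw [h2]
  exact add_nonneg (star_mul_self_nonneg _) (star_mul_self_nonneg _)

end BlockMatrices

/-! ### Complete contractivity and permanence of completely positive contractions. -/

section CompletelyContractive

variable {n A : Type*} [NonUnitalCStarAlgebra A]

lemma continuous_map_matrix (f : A →L[ℂ] A) :
    Continuous fun M : CStarMatrix n n A => M.map f := by
  refine continuous_pi fun i => continuous_pi fun j => ?_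
  exact f.continuous.comp ((continuous_apply j).comp (continuous_apply i))

lemma tendsto_matrix {ι : Type*} {l : Filter ι} {F : ι → CStarMatrix n n A}
    {M : CStarMatrix n n A} (h : ∀ i j, Tendsto (fun t => F t i j) l (𝓝 (M i j))) :
    Tendsto F l (𝓝 M) :=
  tendsto_pi_nhds.mpr fun i => tendsto_pi_nhds.mpr fun j => h i j

variable [Fintype n] [PartialOrder A] [StarOrderedRing A]

/-- Completely positive contractions are completely contractive. -/
theorem IsCPContraction.norm_map_le {P : A →L[ℂ] A} (hP : IsCPContraction P)
    (M : CStarMatrix n n A) : ‖M.map P‖ ≤ ‖M‖ := by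
  classical
  obtain ⟨⟨φ, hφ⟩, hn⟩ := hP
  have hφ' : ⇑φ = ⇑P := funext hφ
  -- `X` is the limit of its compressions by scalar matrices of an approximate unit. The image of
  -- each compression is a corner of a positive block matrix with diagonal the image of `e * e`, of
  -- norm at most one.
  have unit_ball (X : CStarMatrix n n A) (hX : ‖X‖ ≤ 1) : ‖X.map P‖ ≤ 1 := by
    have hl := CStarAlgebra.increasingApproximateUnit A
    have hlim : Tendsto (fun e : A => (scalarHom (n := n) e * X * scalarHom (n := n) e :
        CStarMatrix n n A))
        (CStarAlgebra.approximateUnit A) (𝓝 X) := by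
      refine tendsto_matrix fun i j => ?_
      simp only [scalarHom_mul_mul_apply]
      have h1 := hl.tendsto_mul_left (X i j)
      have h2 := hl.tendsto_mul_right (X i j)
      rw [tendsto_iff_norm_sub_tendsto_zero] at h1 h2 ⊢
      refine squeeze_zero' (Eventually.of_forall fun _ => norm_nonneg _) ?_
        (by simpa using h1.add h2)
      filter_upwards [hl.eventually_norm] with e he
      calc ‖e * X i j * e - X i j‖ = ‖e * (X i j * e - X i j) + (e * X i j - X i j)‖ := by
            congr 1; noncomm_ring
        _ ≤ ‖e‖ * ‖X i j * e - X i j‖ + ‖e * X i j - X i j‖ :=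
            (norm_add_le _ _).trans (by gcongr; exact norm_mul_le _ _)
        _ ≤ 1 * ‖X i j * e - X i j‖ + ‖e * X i j - X i j‖ := by gcongr
        _ = _ := by rw [one_mul]
    have hlim' := ((continuous_map_matrix P).tendsto X).comp hlim
    refine le_of_tendsto hlim'.norm ?_
    filter_upwards [hl.eventually_norm, hl.eventually_star_eq] with e he hstar
    have hs : star (scalarHom (n := n) e) = scalarHom e := by rw [← map_star, hstar]
    have hpos := φ.map_cstarMatrix_nonneg _ (blocks_nonneg_of_norm_le_one (e := scalarHom e) hX)
    rw [blocks_map, hs, hφ', ← map_mul] at hpos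
    have hcorner : ‖(scalarHom (n := n) (e * e)).map P‖ ≤ 1 := by
      have := scalarHom_map (n := n) (P : A →ₗ[ℂ] A) (e * e)
      rw [ContinuousLinearMap.coe_coe] at this
      rw [this]
      calc _ ≤ ‖P (e * e)‖ := NonUnitalStarAlgHom.norm_apply_le _ _
        _ ≤ 1 * ‖e * e‖ := P.le_of_opNorm_le hn _
        _ ≤ 1 * (‖e‖ * ‖e‖) := by gcongr; exact norm_mul_le _ _
        _ ≤ 1 := by rw [one_mul]; exact mul_le_one₀ he (norm_nonneg _) he
    exact norm_off_diagonal_le_one hpos hcorner hcorner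
  rcases eq_or_ne M 0 with rfl | hM
  · have : (0 : CStarMatrix n n A).map P = 0 := by ext; simp
    simp [this]
  · have hM' : 0 < ‖M‖ := norm_pos_iff.mpr hM
    have hle := unit_ball (((‖M‖⁻¹ : ℝ) : ℂ) • M) (by
      rw [norm_smul]; simp [hM'.ne'])
    have hsmul : ((((‖M‖⁻¹ : ℝ) : ℂ) • M).map P) = ((‖M‖⁻¹ : ℝ) : ℂ) • M.map P := by
      ext; simp
    rw [hsmul, norm_smul, Complex.norm_real, norm_inv, norm_norm, inv_mul_le_iff₀ hM',
      mul_one] at hle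
    exact hle

lemma IsCompletelyIsometric.norm_apply {V : Submodule ℂ A} {u : V →ₗ[ℂ] V}
    (hu : IsCompletelyIsometric V u) (x : V) : ‖u x‖ = ‖x‖ := by
  have key (a : A) : ‖CStarMatrix.ofMatrix fun _ _ : Fin 1 => a‖ = ‖a‖ :=
    le_antisymm
      (by
        have hs : (CStarMatrix.ofMatrix fun _ _ : Fin 1 => a) = scalarHom a := by
          ext i j
          fin_cases i; fin_cases j; rfl
        rw [hs]
        exact NonUnitalStarAlgHom.norm_apply_le _ a)
      (CStarMatrix.norm_entry_le_norm (M := CStarMatrix.ofMatrix fun _ _ : Fin 1 => a)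
        (i := 0) (j := 0))
  have h : ‖CStarMatrix.ofMatrix fun _ _ : Fin 1 => ((u x : V) : A)‖ =
      ‖CStarMatrix.ofMatrix fun _ _ : Fin 1 => (x : A)‖ := hu 1 (CStarMatrix.ofMatrix fun _ _ => x)
  rw [key, key] at h
  exact h

lemma IsCPContraction.comp {P Q : A →L[ℂ] A} (hP : IsCPContraction P) (hQ : IsCPContraction Q) :
    IsCPContraction (P * Q) := by
  obtain ⟨⟨φ, hφ⟩, hp⟩ := hP
  obtain ⟨⟨ψ, hψ⟩, hq⟩ := hQ
  refine ⟨⟨⟨((P * Q : A →L[ℂ] A) : A →ₗ[ℂ] A), fun k M hM => ?_⟩, fun a => rfl⟩, ?_⟩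
  · have h := φ.map_cstarMatrix_nonneg _ (ψ.map_cstarMatrix_nonneg M hM)
    have hfun : (M.map ψ).map φ = M.map ((P * Q : A →L[ℂ] A) : A →ₗ[ℂ] A) := by
      ext i j
      simp [hφ, hψ]
    rwa [hfun] at h
  · exact (norm_mul_le _ _).trans (mul_le_one₀ hp (norm_nonneg _) hq)

lemma IsCPContraction.pow {P : A →L[ℂ] A} (hP : IsCPContraction P) (k : ℕ) :
    IsCPContraction (P ^ k) := by
  induction k with
  | zero =>
    refine ⟨⟨⟨LinearMap.id, fun k M hM => hM⟩, fun a => rfl⟩, ContinuousLinearMap.norm_id_le⟩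
  | succ k ih => rw [pow_succ]; exact ih.comp hP

lemma IsCPContraction.of_tendsto {ι : Type*} {l : Filter ι} [l.NeBot] {T : ι → A →L[ℂ] A}
    {E : A →L[ℂ] A} (hT : ∀ i, IsCPContraction (T i))
    (h : ∀ a, Tendsto (fun i => T i a) l (𝓝 (E a))) : IsCPContraction E := by
  refine ⟨⟨⟨(E : A →ₗ[ℂ] A), fun k M hM => ?_⟩, fun a => rfl⟩, ?_⟩
  · have hlim : Tendsto (fun i => M.map (T i)) l (𝓝 (M.map E)) :=
      tendsto_matrix fun i j => h (M i j)
    refine ge_of_tendsto hlim (Eventually.of_forall fun i => ?_)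
    obtain ⟨φ, hφ⟩ := (hT i).completelyPositive
    rw [← funext hφ]
    exact φ.map_cstarMatrix_nonneg M hM
  · refine E.opNorm_le_bound zero_le_one fun a => ?_
    exact le_of_tendsto (h a).norm
      (Eventually.of_forall fun i => (T i).le_of_opNorm_le (hT i).norm_le_one a)

end CompletelyContractive

/-! ### An idempotent ultrafilter at infinity. -/

section Ultrafilters

attribute [local instance] Ultrafilter.add Ultrafilter.addSemigroup

/-- There is an ultrafilter on `ℕ` tending to infinity that is idempotent for addition. -/
theorem exists_additively_idempotent_ultrafilter :
    ∃ U : Ultrafilter ℕ, (U : Filter ℕ) ≤ atTop ∧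
      ∀ p : ℕ → Prop, (∀ᶠ n in (U : Filter ℕ), ∀ᶠ m in (U : Filter ℕ), p (n + m)) →
        ∀ᶠ n in (U : Filter ℕ), p n := by
  -- On `ℕ` the principal ultrafilter at `0` would be idempotent; on `ℕ+` every idempotent escapes
  -- to infinity, since `k ≤ n` gives `k + 1 ≤ n + m`.
  obtain ⟨V, hV⟩ := exists_idempotent_of_compact_t2_of_continuous_add_left
    (M := Ultrafilter ℕ+) Ultrafilter.continuous_add_left
  have key (p : ℕ+ → Prop) (h : ∀ᶠ n in (V : Filter ℕ+), ∀ᶠ m in (V : Filter ℕ+), p (n + m)) :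
      ∀ᶠ n in (V : Filter ℕ+), p n := by
    rw [← hV]
    exact (Ultrafilter.eventually_add V V p).mpr h
  refine ⟨V.map (fun n : ℕ+ => (n : ℕ)), ?_, fun p h => ?_⟩
  · refine tendsto_atTop.mpr fun k => ?_
    change ∀ᶠ n : ℕ+ in (V : Filter ℕ+), k ≤ (n : ℕ)
    induction k with
    | zero => exact Eventually.of_forall fun n => Nat.zero_le _
    | succ k ih =>
      refine key _ ?_
      filter_upwards [ih] with n hn
      refine Eventually.of_forall fun m => ?_
      have := m.pos
      rw [PNat.add_coe]
      omega
  · change ∀ᶠ n : ℕ+ in (V : Filter ℕ+), p (n : ℕ)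
    refine key _ ?_
    simp only [PNat.add_coe]
    exact h

lemma _root_.IsCompact.exists_ultrafilter_tendsto {ι Y : Type*} [TopologicalSpace Y] {K : Set Y}
    (hK : IsCompact K) (U : Ultrafilter ι) {f : ι → Y} (hf : ∀ i, f i ∈ K) :
    ∃ y ∈ K, Tendsto f U (𝓝 y) :=
  hK.ultrafilter_le_nhds (U.map f)
    (le_principal_iff.mpr (Filter.mem_map.mpr (Filter.univ_mem' hf)))

end Ultrafilters

/-! ### Limits of powers of a locally finite contraction. -/

section Contractions

variable {X : Type*} [NormedAddCommGroup X] [NormedSpace ℂ X] {T : X →L[ℂ] X}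

lemma pow_add_apply (T : X →L[ℂ] X) (n m : ℕ) (x : X) : (T ^ (n + m)) x = (T ^ n) ((T ^ m) x) := by
  rw [pow_add]; rfl

lemma pow_succ_apply' (T : X →L[ℂ] X) (n : ℕ) (x : X) : (T ^ (n + 1)) x = T ((T ^ n) x) := by
  rw [pow_succ']; rfl

lemma pow_apply_comm (T : X →L[ℂ] X) (n : ℕ) (x : X) : (T ^ n) (T x) = T ((T ^ n) x) := by
  rw [← pow_succ_apply', pow_succ]; rfl

lemma norm_apply_le_of_contraction (hT : ‖T‖ ≤ 1) (x : X) : ‖T x‖ ≤ ‖x‖ := by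
  simpa using T.le_of_opNorm_le hT x

lemma norm_pow_apply_le (hT : ‖T‖ ≤ 1) (n : ℕ) (x : X) : ‖(T ^ n) x‖ ≤ ‖x‖ := by
  induction n with
  | zero => simp
  | succ n ih =>
    rw [pow_succ_apply']
    exact (norm_apply_le_of_contraction hT _).trans ih

lemma norm_pow_apply_antitone (hT : ‖T‖ ≤ 1) (x : X) : Antitone fun n : ℕ => ‖(T ^ n) x‖ := by
  refine antitone_nat_of_succ_le fun n => ?_
  rw [pow_succ_apply']
  exact norm_apply_le_of_contraction hT _

/-- Along an ultrafilter, the powers of a locally finite contraction converge pointwise. -/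
theorem exists_pointwise_ultralimit (hT : ‖T‖ ≤ 1) (hfin : IsLocallyFinite T) (U : Ultrafilter ℕ) :
    ∃ E : X →L[ℂ] X, ∀ x, Tendsto (fun n : ℕ => (T ^ n) x) U (𝓝 (E x)) := by
  have hex (x : X) : ∃ y, Tendsto (fun n : ℕ => (T ^ n) x) U (𝓝 y) := by
    obtain ⟨y, -, hy⟩ := (hfin x).exists_ultrafilter_tendsto U
      (f := fun n : ℕ => (T ^ n) x) fun n => subset_closure ⟨n, rfl⟩
    exact ⟨y, hy⟩
  choose f hf using hex
  let g : X →ₗ[ℂ] X :=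
    { toFun := f
      map_add' := fun x y => tendsto_nhds_unique (hf (x + y)) (by simpa using (hf x).add (hf y))
      map_smul' := fun c x => tendsto_nhds_unique (hf (c • x)) (by simpa using (hf x).const_smul c) }
  refine ⟨g.mkContinuous 1 fun x => ?_, hf⟩
  rw [one_mul]
  exact le_of_tendsto (hf x).norm (Eventually.of_forall fun n => norm_pow_apply_le hT n x)

variable {E : X →L[ℂ] X} {U : Ultrafilter ℕ}

lemma limit_comm (hE : ∀ x, Tendsto (fun n : ℕ => (T ^ n) x) U (𝓝 (E x))) (x : X) :
    E (T x) = T (E x) := by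
  refine tendsto_nhds_unique (hE (T x)) ?_
  simp only [pow_apply_comm]
  exact (T.continuous.tendsto _).comp (hE x)

lemma limit_pow_comm (hE : ∀ x, Tendsto (fun n : ℕ => (T ^ n) x) U (𝓝 (E x))) (n : ℕ) (x : X) :
    E ((T ^ n) x) = (T ^ n) (E x) := by
  induction n with
  | zero => simp
  | succ n ih => rw [pow_succ_apply', limit_comm hE, ih, ← pow_succ_apply']

/-- The limit of the powers along an idempotent ultrafilter is idempotent. -/
lemma limit_idempotent (hT : ‖T‖ ≤ 1)
    (hU : ∀ p : ℕ → Prop, (∀ᶠ n in (U : Filter ℕ), ∀ᶠ m in (U : Filter ℕ), p (n + m)) →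
      ∀ᶠ n in (U : Filter ℕ), p n)
    (hE : ∀ x, Tendsto (fun n : ℕ => (T ^ n) x) U (𝓝 (E x))) (x : X) : E (E x) = E x := by
  refine tendsto_nhds_unique (Metric.tendsto_nhds.mpr fun ε hε => ?_) (hE x)
  refine hU _ ?_
  filter_upwards [Metric.tendsto_nhds.mp (hE (E x)) (ε / 2) (half_pos hε)] with n hn
  filter_upwards [Metric.tendsto_nhds.mp (hE x) (ε / 2) (half_pos hε)] with m hm
  rw [pow_add_apply]
  calc dist ((T ^ n) ((T ^ m) x)) (E (E x))
      ≤ dist ((T ^ n) ((T ^ m) x)) ((T ^ n) (E x)) + dist ((T ^ n) (E x)) (E (E x)) :=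
        dist_triangle _ _ _
    _ < ε / 2 + ε / 2 := by
        refine add_lt_add_of_le_of_lt (le_trans ?_ hm.le) hn
        rw [dist_eq_norm, dist_eq_norm, ← map_sub]
        exact norm_pow_apply_le hT n _
    _ = ε := add_halves ε

/-- The antitone norms of the orbit return to `‖x‖` along `U`, so they never drop. -/
lemma norm_pow_apply_of_limit_eq (hT : ‖T‖ ≤ 1) (hUtop : (U : Filter ℕ) ≤ atTop)
    (hE : ∀ x, Tendsto (fun n : ℕ => (T ^ n) x) U (𝓝 (E x))) {x : X} (hx : E x = x) (n : ℕ) :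
    ‖(T ^ n) x‖ = ‖x‖ := by
  refine le_antisymm (norm_pow_apply_le hT n x) ?_
  have h := hE x
  rw [hx] at h
  refine le_of_tendsto h.norm ?_
  filter_upwards [hUtop (eventually_ge_atTop n)] with m hm
  exact norm_pow_apply_antitone hT x hm

lemma tendsto_norm_pow_apply_zero (hT : ‖T‖ ≤ 1)
    (hE : ∀ x, Tendsto (fun n : ℕ => (T ^ n) x) U (𝓝 (E x))) {x : X} (hx : E x = 0) :
    Tendsto (fun n : ℕ => ‖(T ^ n) x‖) atTop (𝓝 0) := by
  have h := (hE x).norm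
  rw [hx, norm_zero] at h
  refine Metric.tendsto_atTop.mpr fun ε hε => ?_
  obtain ⟨N, hN⟩ := (Metric.tendsto_nhds.mp h ε hε).exists
  refine ⟨N, fun n hn => lt_of_le_of_lt ?_ hN⟩
  simp only [Real.dist_eq, sub_zero, abs_norm]
  exact norm_pow_apply_antitone hT x hn

/-- The restriction of a locally finite contraction to the range of the limit idempotent is
surjective. -/
lemma exists_preimage_of_limit_eq (hfin : IsLocallyFinite T) (hUtop : (U : Filter ℕ) ≤ atTop)
    (hE : ∀ x, Tendsto (fun n : ℕ => (T ^ n) x) U (𝓝 (E x))) (hidem : ∀ x, E (E x) = E x) {x : X}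
    (hx : E x = x) : ∃ y, E y = y ∧ T y = x := by
  -- The preimage is the limit of the orbit delayed by one; the truncation at `n = 0` is invisible
  -- to `U`.
  obtain ⟨y, -, hy⟩ := (hfin x).exists_ultrafilter_tendsto U
    (f := fun n : ℕ => (T ^ (n - 1)) x) fun n => subset_closure ⟨n - 1, rfl⟩
  refine ⟨E y, hidem y, ?_⟩
  have hTy : T y = x := by
    have h := (T.continuous.tendsto _).comp hy
    refine tendsto_nhds_unique h ?_
    have h' := hE x
    rw [hx] at h'
    refine h'.congr' ?_
    filter_upwards [hUtop (eventually_ge_atTop 1)] with n hn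
    rw [Function.comp_apply, ← pow_succ_apply', Nat.sub_add_cancel hn]
  rw [← limit_comm hE, hTy, hx]

/-- An idempotent limit point of the powers of `T` is unique. -/
lemma idempotent_limit_unique (hT : ‖T‖ ≤ 1) (hUtop : (U : Filter ℕ) ≤ atTop)
    (hE : ∀ x, Tendsto (fun n : ℕ => (T ^ n) x) U (𝓝 (E x))) (hidem : ∀ x, E (E x) = E x)
    {F : X →L[ℂ] X} {l : Filter ℕ} [l.NeBot] (hl : l ≤ atTop)
    (hF : ∀ x, Tendsto (fun n : ℕ => (T ^ n) x) l (𝓝 (F x))) (hFF : ∀ x, F (F x) = F x) :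
    F = E := by
  have hFE (x : X) : F x = F (E x) := by
    have h0 : F (x - E x) = 0 := by
      refine tendsto_nhds_unique (hF _) (tendsto_zero_iff_norm_tendsto_zero.mpr ?_)
      refine (tendsto_norm_pow_apply_zero hT hE ?_).mono_left hl
      rw [map_sub, hidem, sub_self]
    rwa [map_sub, sub_eq_zero] at h0
  have hnorm {x : X} (hx : E x = x) : ‖F x‖ = ‖x‖ := by
    refine tendsto_nhds_unique (hF x).norm ?_
    simp only [norm_pow_apply_of_limit_eq hT hUtop hE hx]
    exact tendsto_const_nhds
  have hEF {x : X} (hx : E x = x) : E (F x) = F x := by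
    refine tendsto_nhds_unique ((E.continuous.tendsto _).comp (hF x)) ?_
    refine (hF x).congr fun n => ?_
    rw [Function.comp_apply, limit_pow_comm hE, hx]
  ext x
  have hx := hidem x
  -- `F` is isometric on the range of `E`, yet kills `F (E x) - E x` by idempotence.
  have h : ‖F (E x) - E x‖ = 0 := by
    rw [← hnorm (x := F (E x) - E x) (by rw [map_sub, hEF hx, hx]), map_sub, hFF, sub_self,
      norm_zero]
  rw [hFE x, sub_eq_zero.mp (norm_eq_zero.mp h)]

/-- `E` multiplies `x` by a limit `d` of powers of the eigenvalue; `|d| = 1` and idempotence force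
`d • x = x`. -/
lemma limit_eq_of_isMaximalEigenvector (hidem : ∀ x, E (E x) = E x)
    (hE : ∀ x, Tendsto (fun n : ℕ => (T ^ n) x) U (𝓝 (E x))) {x : X}
    (hx : IsMaximalEigenvector T x) : E x = x := by
  obtain ⟨c, hc, hcx⟩ := hx
  have hTx : T x = c • x := hcx.apply_eq_smul
  have hpow (n : ℕ) : (T ^ n) x = c ^ n • x := by
    induction n with
    | zero => simp
    | succ n ih => rw [pow_succ_apply', ih, map_smul, hTx, smul_smul, pow_succ]
  obtain ⟨d, hd, hdlim⟩ := (isCompact_sphere (0 : ℂ) 1).exists_ultrafilter_tendsto U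
    (f := fun n : ℕ => c ^ n) fun n => by simp [hc]
  have hEx : E x = d • x := by
    refine tendsto_nhds_unique (hE x) ?_
    simp only [hpow]
    exact hdlim.smul_const x
  have hd0 : d ≠ 0 := by
    rintro rfl
    simp at hd
  have h := hidem x
  rw [hEx, map_smul, hEx] at h
  exact hEx.trans (smul_right_injective X hd0 h)

/-- An operator that is isometric on the range of an idempotent through which it factors, and whose
powers are asymptotic to those of `T`, is `T ∘ E`. -/
lemma eq_of_asymptotic (hUtop : (U : Filter ℕ) ≤ atTop)
    (hE : ∀ x, Tendsto (fun n : ℕ => (T ^ n) x) U (𝓝 (E x))) (hidem : ∀ x, E (E x) = E x)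
    {S F : X →L[ℂ] X} (hFF : ∀ x, F (F x) = F x) (hFS : ∀ x, F (S x) = S x)
    (hSF : ∀ x, S (F x) = S x) (hS : ∀ x, F x = x → ‖S x‖ = ‖x‖)
    (hlim : ∀ x, Tendsto (fun n : ℕ => ‖(T ^ n) x - (S ^ n) x‖) atTop (𝓝 0)) :
    F = E ∧ ∀ x, S x = T (E x) := by
  have hSE (x : X) : Tendsto (fun n : ℕ => (S ^ n) x) U (𝓝 (E x)) := by
    have h := tendsto_zero_iff_norm_tendsto_zero.mpr ((hlim x).mono_left hUtop)
    simpa using (hE x).sub h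
  have hFpow {x : X} (hx : F x = x) (n : ℕ) : F ((S ^ n) x) = (S ^ n) x := by
    cases n with
    | zero => simpa using hx
    | succ n => rw [pow_succ_apply', hFS]
  have hnorm {x : X} (hx : F x = x) (n : ℕ) : ‖(S ^ n) x‖ = ‖x‖ := by
    induction n with
    | zero => simp
    | succ n ih => rw [pow_succ_apply', hS _ (hFpow hx n), ih]
  have hnormE {x : X} (hx : F x = x) : ‖E x‖ = ‖x‖ := by
    refine tendsto_nhds_unique (hSE x).norm ?_
    simp only [hnorm hx]
    exact tendsto_const_nhds
  have hFE {x : X} (hx : F x = x) : F (E x) = E x := by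
    refine tendsto_nhds_unique ((F.continuous.tendsto _).comp (hSE x)) ?_
    exact (hSE x).congr fun n => (hFpow hx n).symm
  have hEF {x : X} (hx : F x = x) : E x = x := by
    have h : ‖E x - x‖ = 0 := by
      rw [← hnormE (x := E x - x) (by rw [map_sub, hFE hx, hx]), map_sub, hidem, sub_self,
        norm_zero]
    exact sub_eq_zero.mp (norm_eq_zero.mp h)
  -- From `S ∘ F = S` follows `E ∘ F = E`, while `E` fixes the range of `F`.
  have hFeq : F = E := by
    ext x
    rw [← hEF (hFF x)]
    refine tendsto_nhds_unique (hSE (F x)) ((hSE x).congr' ?_)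
    filter_upwards [hUtop (eventually_ge_atTop 1)] with n hn
    obtain ⟨m, rfl⟩ := Nat.exists_eq_add_of_le' hn
    rw [pow_add_apply, pow_one, pow_add_apply, pow_one, hSF]
  refine ⟨hFeq, fun x => ?_⟩
  have h1 : Tendsto (fun n : ℕ => S ((S ^ n) x)) U (𝓝 (S (E x))) :=
    (S.continuous.tendsto _).comp (hSE x)
  have h2 : Tendsto (fun n : ℕ => T ((T ^ n) x)) U (𝓝 (T (E x))) :=
    (T.continuous.tendsto _).comp (hE x)
  have h3 : Tendsto (fun n : ℕ => T ((T ^ n) x) - S ((S ^ n) x)) U (𝓝 0) := by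
    refine tendsto_zero_iff_norm_tendsto_zero.mpr (Tendsto.mono_left ?_ hUtop)
    simpa only [Function.comp_def, pow_succ_apply'] using (hlim x).comp (tendsto_add_atTop_nat 1)
  have h4 := tendsto_nhds_unique h3 (h2.sub h1)
  rw [← hSF x, hFeq]
  exact (sub_eq_zero.mp h4.symm).symm

lemma mem_strongClusterPoints_iff {F : X →L[ℂ] X} :
    F ∈ strongClusterPoints T ↔ ∃ V : Ultrafilter ℕ, (V : Filter ℕ) ≤ atTop ∧
      ∀ x, Tendsto (fun n : ℕ => (T ^ n) x) V (𝓝 (F x)) := by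
  let ι := ContinuousLinearMap.toPointwiseConvergenceCLM ℂ (RingHom.id ℂ) X X
  have htendsto (V : Ultrafilter ℕ) : Tendsto (fun n => ι (T ^ n)) V (𝓝 (ι F)) ↔
      ∀ x, Tendsto (fun n : ℕ => (T ^ n) x) V (𝓝 (F x)) :=
    PointwiseConvergenceCLM.tendsto_iff_forall_tendsto
  simp only [← htendsto, ← mapClusterPt_iff_ultrafilter]
  constructor
  · intro h
    refine mapClusterPt_iff_frequently.mpr fun s hs => ?_
    refine frequently_atTop.mpr fun n => ?_
    obtain ⟨_, hys, k, hk, rfl⟩ := mem_closure_iff_nhds.mp (h (n + 1) (by omega)) s hs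
    exact ⟨k, by omega, hys⟩
  · intro h n _
    refine mem_closure_iff_nhds.mpr fun s hs => ?_
    obtain ⟨k, hk, hks⟩ := frequently_atTop.mp (mapClusterPt_iff_frequently.mp h s hs) n
    exact ⟨_, hks, k, hk, rfl⟩

end Contractions

/-! ### A lower bound for trigonometric sums. -/

section Fourier

lemma sum_mul_ite_eq (f : ℕ → ℂ) {N k l : ℕ} (hk : k < N) :
    ∑ n ∈ Finset.range N, f n * (if k = l + n then 1 else 0) = if l ≤ k then f (k - l) else 0 := by
  split_ifs with hlk
  · rw [Finset.sum_eq_single (k - l)]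
    · simp [Nat.add_sub_cancel' hlk]
    · intro n _ hn
      rw [if_neg (by omega), mul_zero]
    · intro h
      exact absurd (Finset.mem_range.mpr (by omega)) h
  · refine Finset.sum_eq_zero fun n _ => ?_
    rw [if_neg (by omega), mul_zero]

/-- The modulus `2 * N` exceeds both `k` and `l + n`, so congruence is equality, without
wrap-around. -/
lemma sum_stdAddChar_mul {N : ℕ} [NeZero (2 * N)] {k l n : ℕ} (hk : k < N) (hl : l < N)
    (hn : n < N) :
    ∑ j : ZMod (2 * N),
        ZMod.stdAddChar (j * ((k : ZMod (2 * N)) - (l : ZMod (2 * N)) - (n : ZMod (2 * N)))) =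
      (2 * N : ℂ) * (if k = l + n then 1 else 0) := by
  have hiff : ((k : ZMod (2 * N)) - (l : ZMod (2 * N)) - (n : ZMod (2 * N)) = 0) ↔ k = l + n := by
    rw [sub_sub, sub_eq_zero, ← Nat.cast_add, ZMod.natCast_eq_natCast_iff',
      Nat.mod_eq_of_lt (by omega), Nat.mod_eq_of_lt (by omega)]
  rw [AddChar.sum_mulShift _ (ZMod.isPrimitive_stdAddChar (2 * N))]
  simp only [hiff, ZMod.card]
  split_ifs <;> simp

lemma card_sq_le_two_mul_card_pairs (S : Finset ℕ) :
    S.card ^ 2 ≤ 2 * ((S ×ˢ S).filter fun p => p.2 ≤ p.1).card := by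
  have hswap : ((S ×ˢ S).filter fun p => ¬ p.2 ≤ p.1).card ≤
      ((S ×ˢ S).filter fun p => p.2 ≤ p.1).card := by
    refine Finset.card_le_card_of_injOn Prod.swap ?_ Prod.swap_injective.injOn
    intro p hp
    simp only [Finset.coe_filter, Finset.mem_product, Set.mem_ofPred_eq, not_le] at hp ⊢
    exact ⟨⟨hp.1.2, hp.1.1⟩, hp.2.le⟩
  have hsum := Finset.card_filter_add_card_filter_not (s := S ×ˢ S) (fun p => p.2 ≤ p.1)
  rw [Finset.card_product, ← sq] at hsum
  omega

/-- If a sequence stays close to its first term at all differences of elements of `S ⊆ [0, N)`,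
then one of its trigonometric sums of length `N` is bounded below. -/
theorem exists_le_norm_trigonometric_sum (f : ℕ → ℂ) {N : ℕ} (hN : 0 < N) {S : Finset ℕ}
    (hS : S ⊆ Finset.range N) (hS0 : S.Nonempty)
    (hf : ∀ k ∈ S, ∀ l ∈ S, l ≤ k → ‖f (k - l) - f 0‖ ≤ ‖f 0‖ / 2) :
    ∃ z : ℂ, ‖z‖ = 1 ∧ S.card * ‖f 0‖ / 4 ≤ ‖∑ n ∈ Finset.range N, z ^ n * f n‖ := by
  have : NeZero (2 * N) := ⟨by omega⟩
  have hSlt {k : ℕ} (hk : k ∈ S) : k < N := Finset.mem_range.mp (hS hk)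
  let ψ : AddChar (ZMod (2 * N)) ℂ := ZMod.stdAddChar
  have hψ (j : ZMod (2 * N)) : ‖ψ j‖ = 1 := AddChar.norm_apply ψ j
  -- `G` collects the sums to be bounded; they are averaged against `|H|²`, where `H` is the
  -- transform of the indicator of `S`.
  let G (j : ZMod (2 * N)) : ℂ := ∑ n ∈ Finset.range N, ψ (-j) ^ n * f n
  let H (j : ZMod (2 * N)) : ℂ := ∑ k ∈ S, ψ (j * k)
  let H' (j : ZMod (2 * N)) : ℂ := ∑ l ∈ S, ψ (-(j * l))
  have hH' (j) : H' j = star (H j) := by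
    simp only [H, H', star_sum]
    refine Finset.sum_congr rfl fun l _ => ?_
    rw [AddChar.map_neg_eq_conj]; rfl
  have hHH' (j) : H j * H' j = ∑ k ∈ S, ∑ l ∈ S, ψ (j * ((k : ZMod (2 * N)) - l)) := by
    simp only [H, H', Finset.sum_mul_sum]
    refine Finset.sum_congr rfl fun k _ => Finset.sum_congr rfl fun l _ => ?_
    rw [← AddChar.map_add_eq_mul, mul_sub, sub_eq_add_neg]
  let pairs := (S ×ˢ S).filter fun p => p.2 ≤ p.1
  -- Orthogonality of characters leaves only `n = k - l`.
  have hGHH : ∑ j, G j * (H j * H' j) = 2 * N * ∑ p ∈ pairs, f (p.1 - p.2) := by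
    have hterm (j) : G j * (H j * H' j) = ∑ k ∈ S, ∑ l ∈ S, ∑ n ∈ Finset.range N,
        f n * ψ (j * ((k : ZMod (2 * N)) - l - n)) := by
      rw [hHH']
      simp only [G, Finset.mul_sum, Finset.sum_mul]
      refine Finset.sum_congr rfl fun k _ => Finset.sum_congr rfl fun l _ =>
        Finset.sum_congr rfl fun n _ => ?_
      rw [← AddChar.map_nsmul_eq_pow, mul_comm (ψ _) (f n), mul_assoc, ← AddChar.map_add_eq_mul]
      congr 2
      rw [nsmul_eq_mul]
      ring
    simp only [hterm]
    rw [Finset.sum_comm, Finset.sum_filter, Finset.sum_product, Finset.mul_sum]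
    refine Finset.sum_congr rfl fun k hk => ?_
    rw [Finset.sum_comm, Finset.mul_sum]
    refine Finset.sum_congr rfl fun l hl => ?_
    rw [Finset.sum_comm, ← sum_mul_ite_eq f (hSlt hk), Finset.mul_sum]
    refine Finset.sum_congr rfl fun n hn => ?_
    rw [← Finset.mul_sum, sum_stdAddChar_mul (hSlt hk) (hSlt hl) (Finset.mem_range.mp hn)]
    ring
  -- Parseval for the indicator of `S`.
  have hHH : ∑ j, ‖H j‖ ^ 2 = 2 * N * S.card := by
    have hcomplex : ∑ j, H j * H' j = (2 * N * S.card : ℂ) := by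
      have hterm (j) : H j * H' j = ∑ k ∈ S, ∑ l ∈ S,
          ψ (j * ((k : ZMod (2 * N)) - l - (0 : ℕ))) := by
        simp only [hHH', Nat.cast_zero, sub_zero]
      have hconst : (2 * N * S.card : ℂ) = ∑ k ∈ S, (2 * N : ℂ) := by
        rw [Finset.sum_const, nsmul_eq_mul, mul_comm]
      simp only [hterm]
      rw [Finset.sum_comm, hconst]
      refine Finset.sum_congr rfl fun k hk => ?_
      rw [Finset.sum_comm, Finset.sum_eq_single_of_mem k hk]
      · rw [sum_stdAddChar_mul (hSlt hk) (hSlt hk) hN]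
        simp
      · intro l hl hlk
        rw [sum_stdAddChar_mul (hSlt hk) (hSlt hl) hN, if_neg (by omega), mul_zero]
    have hreal : ((∑ j, ‖H j‖ ^ 2 : ℝ) : ℂ) = (2 * N * S.card : ℂ) := by
      rw [← hcomplex]
      push_cast
      refine Finset.sum_congr rfl fun j _ => ?_
      rw [hH']
      exact (Complex.mul_conj' (H j)).symm
    exact_mod_cast hreal
  have hNpos : (0 : ℝ) < 2 * N := by positivity
  -- At least `|S|² / 2` pairs occur, and their terms together deviate from copies of `f 0` by at
  -- most half: hence the `4`.
  have hlower : (S.card : ℝ) ^ 2 * ‖f 0‖ / 4 ≤ ‖∑ p ∈ pairs, f (p.1 - p.2)‖ := by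
    have hdiff : ‖∑ p ∈ pairs, (f (p.1 - p.2) - f 0)‖ ≤ pairs.card * (‖f 0‖ / 2) := by
      rw [← nsmul_eq_mul]
      refine Finset.sum_le_card_nsmul _ _ _ (fun p hp => ?_) |> (norm_sum_le _ _).trans
      simp only [pairs, Finset.mem_filter, Finset.mem_product] at hp
      exact hf _ hp.1.1 _ hp.1.2 hp.2
    rw [Finset.sum_sub_distrib, Finset.sum_const, nsmul_eq_mul] at hdiff
    have htri := norm_sub_norm_le ((pairs.card : ℂ) * f 0) (∑ p ∈ pairs, f (p.1 - p.2))
    rw [norm_sub_rev, norm_mul, Complex.norm_natCast] at htri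
    have hcard : (S.card : ℝ) ^ 2 ≤ 2 * pairs.card := by
      exact_mod_cast card_sq_le_two_mul_card_pairs S
    have := mul_le_mul_of_nonneg_right hcard (norm_nonneg (f 0))
    linarith
  by_contra! hcon
  have hSpos : (0 : ℝ) < S.card := by exact_mod_cast hS0.card_pos
  have hupper : ‖∑ j, G j * (H j * H' j)‖ < 2 * N * ((S.card : ℝ) ^ 2 * ‖f 0‖ / 4) := by
    have hle (j) : ‖G j * (H j * H' j)‖ ≤ (S.card * ‖f 0‖ / 4) * ‖H j‖ ^ 2 := by
      rw [norm_mul, norm_mul, hH', norm_star, ← sq]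
      gcongr
      exact (hcon _ (hψ (-j))).le
    -- A nonzero weight at `j = 0` makes the summed inequality strict.
    have h0 : H 0 = S.card := by simp [H]
    calc ‖∑ j, G j * (H j * H' j)‖ ≤ ∑ j, ‖G j * (H j * H' j)‖ := norm_sum_le _ _
      _ < ∑ j, (S.card * ‖f 0‖ / 4) * ‖H j‖ ^ 2 := by
        refine Finset.sum_lt_sum (fun j _ => hle j) ⟨0, Finset.mem_univ _, ?_⟩
        rw [norm_mul, norm_mul, hH', norm_star, ← sq]
        refine mul_lt_mul_of_pos_right (hcon _ (hψ _)) ?_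
        rw [h0, Complex.norm_natCast]
        positivity
      _ = 2 * N * ((S.card : ℝ) ^ 2 * ‖f 0‖ / 4) := by
        rw [← Finset.mul_sum, hHH]
        ring
  rw [hGHH, norm_mul] at hupper
  have h2N : ‖(2 * N : ℂ)‖ = 2 * N := by simp
  rw [h2N] at hupper
  exact absurd (lt_of_mul_lt_mul_left hupper hNpos.le) (not_lt.mpr hlower)

end Fourier

/-! ### Maximal eigenvectors from twisted averages. -/

section Eigenvectors

variable {X : Type*} [NormedAddCommGroup X] [NormedSpace ℂ X] {T : X →L[ℂ] X}

/-- The scalar multiples of an orbit by numbers of absolute value one have all their convex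
combinations in a compact set. -/
lemma exists_compact_convex_of_isLocallyFinite [CompleteSpace X] (hfin : IsLocallyFinite T)
    (x : X) : ∃ C : Set X, IsCompact C ∧ Convex ℝ C ∧
      ∀ (z : ℂ) (n : ℕ), ‖z‖ = 1 → z • (T ^ n) x ∈ C := by
  let K := closure (Set.range fun n : ℕ => (T ^ n) x)
  let D := (fun p : ℂ × X => p.1 • p.2) '' (Metric.sphere (0 : ℂ) 1 ×ˢ K)
  have hD : IsCompact D :=
    ((isCompact_sphere (0 : ℂ) 1).prod (hfin x)).image continuous_smul
  refine ⟨closure (convexHull ℝ D), ?_, (convex_convexHull ℝ D).closure, fun z n hz => ?_⟩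
  · exact hD.totallyBounded.convexHull.closure.isCompact_of_isClosed isClosed_closure
  · refine subset_closure (subset_convexHull ℝ D ⟨(z, (T ^ n) x), ⟨?_, ?_⟩, rfl⟩)
    · simpa using hz
    · exact subset_closure ⟨n, rfl⟩

/-- Pigeonhole on a cover of the orbit by `r` balls of radius `η`, with `r` independent of `N`. -/
lemma exists_index_set (hfin : IsLocallyFinite T) (x : X) {η : ℝ} (hη : 0 < η) :
    ∃ r : ℕ, 0 < r ∧ ∀ N : ℕ, ∃ S ⊆ Finset.range N, (N : ℝ) / r ≤ S.card ∧
      ∀ k ∈ S, ∀ l ∈ S, ‖(T ^ k) x - (T ^ l) x‖ ≤ 2 * η := by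
  obtain ⟨t, -, ht, hcover⟩ := (hfin x).finite_cover_balls hη
  have hball (n : ℕ) : ∃ y ∈ ht.toFinset, dist ((T ^ n) x) y < η := by
    obtain ⟨y, hy, hxy⟩ := Set.mem_iUnion₂.mp (hcover (subset_closure ⟨n, rfl⟩))
    exact ⟨y, ht.mem_toFinset.mpr hy, hxy⟩
  choose c hct hc using hball
  have ht0 : ht.toFinset.Nonempty := ⟨c 0, hct 0⟩
  refine ⟨ht.toFinset.card, ht0.card_pos, fun N => ?_⟩
  have hpos : (0 : ℝ) < ht.toFinset.card := by exact_mod_cast ht0.card_pos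
  classical
  obtain ⟨y, -, hy⟩ := Finset.exists_le_card_fiber_of_nsmul_le_card_of_maps_to
    (s := Finset.range N) (f := c) (b := (N : ℝ) / ht.toFinset.card) (fun n _ => hct n) ht0 (by
      rw [nsmul_eq_mul, Finset.card_range, mul_div_cancel₀ _ hpos.ne'])
  refine ⟨_, Finset.filter_subset _ _, hy, fun k hk l hl => ?_⟩
  rw [← dist_eq_norm, two_mul]
  refine (dist_triangle_right _ _ y).trans (add_le_add ?_ ?_)
  · rw [← (Finset.mem_filter.mp hk).2]; exact (hc k).le
  · rw [← (Finset.mem_filter.mp hl).2]; exact (hc l).le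

/-- On a vector along whose orbit a locally finite operator acts isometrically, any functional that
does not vanish is nonzero at some maximal eigenvector. -/
theorem exists_isMaximalEigenvector [CompleteSpace X] (hfin : IsLocallyFinite T) {x : X}
    (hiso : ∀ k l : ℕ, l ≤ k → ‖(T ^ k) x - (T ^ l) x‖ = ‖(T ^ (k - l)) x - x‖)
    (hbdd : ∀ n, ‖(T ^ n) x‖ ≤ ‖x‖)
    (φ : StrongDual ℂ X) (hφ : φ x ≠ 0) : ∃ y, IsMaximalEigenvector T y ∧ φ y ≠ 0 := by
  have hφx : 0 < ‖φ x‖ := norm_pos_iff.mpr hφ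
  let η := ‖φ x‖ / (4 * (‖φ‖ + 1))
  have hη : 0 < η := by positivity
  have hφη : ‖φ‖ * (2 * η) ≤ ‖φ x‖ / 2 := by
    have h1 : (‖φ‖ + 1) * (2 * η) = ‖φ x‖ / 2 := by
      simp only [η]
      field_simp
      norm_num
    rw [← h1]
    gcongr
    linarith
  obtain ⟨r, hr, hrS⟩ := exists_index_set hfin x hη
  have hz (N : ℕ) : ∃ z : ℂ, ‖z‖ = 1 ∧ (N + 1 : ℝ) / r * (‖φ x‖ / 4) ≤
      ‖∑ n ∈ Finset.range (N + 1), z ^ n * φ ((T ^ n) x)‖ := by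
    obtain ⟨S, hSN, hcard, hS⟩ := hrS (N + 1)
    push_cast at hcard
    have hS0 : S.Nonempty := by
      rw [← Finset.card_pos]
      have : (0 : ℝ) < S.card := lt_of_lt_of_le (by positivity) hcard
      exact_mod_cast this
    obtain ⟨z, hz, hzS⟩ := exists_le_norm_trigonometric_sum (fun n => φ ((T ^ n) x))
      (Nat.succ_pos N) hSN hS0 fun k hk l hl hlk => by
        have h0 : (T ^ 0) x = x := by simp
        simp only [h0]
        rw [← map_sub]
        refine (φ.le_opNorm _).trans (le_trans ?_ hφη)
        rw [← hiso k l hlk]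
        gcongr
        exact hS k hk l hl
    refine ⟨z, hz, le_trans ?_ hzS⟩
    simp only [pow_zero, one_apply_eq_self]
    rw [mul_div_assoc]
    gcongr
  choose z hz hzsum using hz
  -- Twisted Cesàro averages: they stay in a compact convex set, and `z N • T` moves them by `O(1 /
  -- N)` by telescoping.
  let y (N : ℕ) : X := ∑ n ∈ Finset.range (N + 1), ((N + 1 : ℝ)⁻¹) • (z N ^ n • (T ^ n) x)
  obtain ⟨C, hC, hCconv, hCmem⟩ := exists_compact_convex_of_isLocallyFinite hfin x
  have hyC (N : ℕ) : y N ∈ C := by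
    refine hCconv.sum_mem (fun _ _ => by positivity) ?_ fun n _ => hCmem _ _ (by simp [hz])
    rw [Finset.sum_const, Finset.card_range, nsmul_eq_mul]
    push_cast
    exact mul_inv_cancel₀ (by positivity)
  let U : Ultrafilter ℕ := hyperfilter ℕ
  have hU : (U : Filter ℕ) ≤ atTop := Nat.hyperfilter_le_atTop
  obtain ⟨w, hw, hwlim⟩ := (isCompact_sphere (0 : ℂ) 1).exists_ultrafilter_tendsto U (f := z)
    fun N => by simp [hz]
  obtain ⟨v, -, hvlim⟩ := hC.exists_ultrafilter_tendsto U hyC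
  have hw1 : ‖w‖ = 1 := by simpa using hw
  have hw0 : w ≠ 0 := by
    rintro rfl
    simp at hw1
  have hshift (N : ℕ) : ‖z N • T (y N) - y N‖ ≤ (2 * ‖x‖) * (1 / ((N : ℝ) + 1)) := by
    have h1 : z N • T (y N) - y N =
        ((N + 1 : ℝ)⁻¹) • (z N ^ (N + 1) • (T ^ (N + 1)) x - x) := by
      have h2 : z N • T (y N) = ∑ n ∈ Finset.range (N + 1),
          ((N + 1 : ℝ)⁻¹) • (z N ^ (n + 1) • (T ^ (n + 1)) x) := by
        simp only [y, map_sum, Finset.smul_sum]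
        refine Finset.sum_congr rfl fun n _ => ?_
        rw [ContinuousLinearMap.map_smul_of_tower, map_smul, ← pow_succ_apply', smul_comm,
          smul_smul, ← pow_succ']
      rw [h2, ← Finset.sum_sub_distrib]
      simp only [← smul_sub]
      rw [← Finset.smul_sum, Finset.sum_range_sub (fun n => z N ^ n • (T ^ n) x)]
      simp
    rw [h1, norm_smul, norm_inv, Real.norm_of_nonneg (by positivity), mul_comm, one_div]
    gcongr
    refine (norm_sub_le _ _).trans ?_
    rw [norm_smul, norm_pow, hz, one_pow, one_mul, two_mul]
    gcongr
    exact hbdd _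
  have heig : w • T v = v := by
    have h1 : Tendsto (fun N => z N • T (y N) - y N) U (𝓝 (w • T v - v)) :=
      (hwlim.smul ((T.continuous.tendsto v).comp hvlim)).sub hvlim
    have h2 : Tendsto (fun N => z N • T (y N) - y N) U (𝓝 0) := by
      refine squeeze_zero_norm hshift (Tendsto.mono_left ?_ hU)
      simpa using tendsto_one_div_add_atTop_nhds_zero_nat.const_mul (2 * ‖x‖)
    exact sub_eq_zero.mp (tendsto_nhds_unique h1 h2)
  have hφv : φ v ≠ 0 := by
    have hbound (N : ℕ) : ‖φ x‖ / 4 / r ≤ ‖φ (y N)‖ := by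
      have h1 : φ (y N) = ((N + 1 : ℝ)⁻¹) •
          ∑ n ∈ Finset.range (N + 1), z N ^ n * φ ((T ^ n) x) := by
        simp only [y, map_sum, Finset.smul_sum]
        refine Finset.sum_congr rfl fun n _ => ?_
        rw [ContinuousLinearMap.map_smul_of_tower, map_smul, smul_eq_mul]
      rw [h1, norm_smul, norm_inv, Real.norm_of_nonneg (by positivity), inv_mul_eq_div,
        le_div_iff₀ (by positivity)]
      refine le_of_eq_of_le ?_ (hzsum N)
      ring
    have hlim := ge_of_tendsto ((φ.continuous.tendsto v).comp hvlim).norm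
      (Eventually.of_forall hbound)
    have : 0 < ‖φ x‖ / 4 / r := by positivity
    exact norm_pos_iff.mp (this.trans_le hlim)
  refine ⟨v, ⟨w⁻¹, by rw [norm_inv, hw1, inv_one], ?_⟩, hφv⟩
  refine Module.End.hasEigenvector_iff.mpr ⟨Module.End.mem_eigenspace_iff.mpr ?_, ?_⟩
  · rw [ContinuousLinearMap.coe_coe, eq_inv_smul_iff₀ hw0]
    exact heig
  · rintro rfl
    simp at hφv

/-- For a vector outside a closed subspace, some functional annihilates the subspace but does not
vanish at the vector. -/
lemma exists_dual_vanishing_on_of_notMem {W : Submodule ℂ X} (hW : IsClosed (W : Set X)) {x : X}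
    (hx : x ∉ W) : ∃ φ : StrongDual ℂ X, (∀ w ∈ W, φ w = 0) ∧ φ x ≠ 0 := by
  have : IsClosed (W : Set X) := hW
  have hne : W.mkQ x ≠ 0 := by simpa using hx
  obtain ⟨f, hf⟩ := SeparatingDual.exists_ne_zero (R := ℂ) hne
  refine ⟨f.comp W.mkQL, fun w hw => ?_, by simpa using hf⟩
  have : W.mkQ w = 0 := by simpa using hw
  simp only [ContinuousLinearMap.comp_apply, Submodule.mkQL_apply, this, map_zero]

variable {E : X →L[ℂ] X} {U : Ultrafilter ℕ}

/-- The range of the limit idempotent is the closed span of the maximal eigenvectors. -/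
theorem range_limit_eq_closure_span [CompleteSpace X] (hT : ‖T‖ ≤ 1) (hfin : IsLocallyFinite T)
    (hUtop : (U : Filter ℕ) ≤ atTop)
    (hE : ∀ x, Tendsto (fun n : ℕ => (T ^ n) x) U (𝓝 (E x))) (hidem : ∀ x, E (E x) = E x) :
    (E : X →ₗ[ℂ] X).range =
      (Submodule.span ℂ {a : X | IsMaximalEigenvector T a}).topologicalClosure := by
  have hmem (x : X) : x ∈ (E : X →ₗ[ℂ] X).range ↔ E x = x :=
    ⟨by rintro ⟨y, rfl⟩; exact hidem y, fun h => ⟨x, h⟩⟩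
  apply le_antisymm
  · intro x hx
    rw [hmem] at hx
    by_contra hxW
    obtain ⟨φ, hφW, hφx⟩ :=
      exists_dual_vanishing_on_of_notMem (Submodule.isClosed_topologicalClosure _) hxW
    -- Differences of orbit points are fixed by `E`, so powers of `T` preserve their norms.
    obtain ⟨y, hy, hφy⟩ := exists_isMaximalEigenvector hfin (x := x) (fun k l hlk => by
      have h : E ((T ^ (k - l)) x - x) = (T ^ (k - l)) x - x := by
        rw [map_sub, limit_pow_comm hE, hx]
      rw [← norm_pow_apply_of_limit_eq hT hUtop hE h l, map_sub, ← pow_add_apply,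
        Nat.add_sub_cancel' hlk]) (fun n => norm_pow_apply_le hT n x) φ hφx
    exact hφy (hφW y (Submodule.le_topologicalClosure _ (Submodule.subset_span hy)))
  · refine Submodule.topologicalClosure_minimal _ (Submodule.span_le.mpr fun x hx => ?_) ?_
    · exact (hmem x).mpr (limit_eq_of_isMaximalEigenvector hidem hE hx)
    · have : ((E : X →ₗ[ℂ] X).range : Set X) = {x | E x = x} := Set.ext hmem
      rw [this]
      exact isClosed_eq E.continuous continuous_id

end Eigenvectors

/-! ### Existence and rigidity of factorizations. -/

section Quasiautomorphisms

variable {A : Type*} [NonUnitalCStarAlgebra A] [PartialOrder A] [StarOrderedRing A]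

/-- Restricting a completely positive contraction `P` to the range of a limit idempotent `E` of its
powers gives a factorization of `P ∘ E`. -/
theorem exists_isFactorization {P E : A →L[ℂ] A} {U : Ultrafilter ℕ} (hP : IsCPContraction P)
    (hfin : IsLocallyFinite P) (hUtop : (U : Filter ℕ) ≤ atTop)
    (hE : ∀ a, Tendsto (fun n : ℕ => (P ^ n) a) U (𝓝 (E a))) (hidem : ∀ a, E (E a) = E a) :
    ∃ α : (E : A →ₗ[ℂ] A).range →ₗ[ℂ] (E : A →ₗ[ℂ] A).range, IsFactorization (P * E) E α := by
  have hinv : ∀ x ∈ (E : A →ₗ[ℂ] A).range, (P : A →ₗ[ℂ] A) x ∈ (E : A →ₗ[ℂ] A).range := by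
    rintro _ ⟨a, rfl⟩
    exact ⟨P a, limit_comm hE a⟩
  have hfix (x : (E : A →ₗ[ℂ] A).range) : E x = x := by
    obtain ⟨_, a, rfl⟩ := x
    exact hidem a
  refine ⟨(P : A →ₗ[ℂ] A).restrict hinv, ?_, ?_, ?_, ?_, ?_⟩
  · exact .of_tendsto (fun n => hP.pow n) hE
  · ext a
    exact hidem a
  · intro n M
    refine le_antisymm (hP.norm_map_le (M.map fun v => (v : A))) ?_
    -- Recurrence gives the reverse inequality: `M` is a limit of its images under `P ^ (m + 1)`,
    -- each of norm at most that of its image under `P`.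
    have hlim : Tendsto (fun k : ℕ => (M.map fun v => (v : A)).map (P ^ k)) U
        (𝓝 (M.map fun v => (v : A))) := by
      refine tendsto_matrix fun i j => ?_
      have h := hE (M i j)
      rwa [hfix] at h
    refine le_of_tendsto hlim.norm ?_
    filter_upwards [hUtop (eventually_ge_atTop 1)] with k hk
    obtain ⟨m, rfl⟩ := Nat.exists_eq_add_of_le' hk
    have h := (hP.pow m).norm_map_le (M.map fun v => (P v : A))
    refine le_trans (le_of_eq ?_) h
    congr 1
  · intro x
    obtain ⟨y, hy, hPy⟩ := exists_preimage_of_limit_eq hfin hUtop hE hidem (hfix x)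
    exact ⟨⟨y, y, hy⟩, Subtype.ext hPy⟩
  · exact fun a => rfl

/-- A factorized map whose powers are asymptotic to those of `P` is `P ∘ E`, where `E` is the limit
idempotent of `P`, which is also the idempotent of the factorization. -/
lemma IsFactorization.eq_of_asymptotic {P E Q F : A →L[ℂ] A} {U : Ultrafilter ℕ}
    (hUtop : (U : Filter ℕ) ≤ atTop)
    (hE : ∀ a, Tendsto (fun n : ℕ => (P ^ n) a) U (𝓝 (E a))) (hidem : ∀ a, E (E a) = E a)
    {α : (F : A →ₗ[ℂ] A).range →ₗ[ℂ] (F : A →ₗ[ℂ] A).range} (h : IsFactorization Q F α)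
    (hlim : ∀ a, Tendsto (fun n : ℕ => ‖(P ^ n) a - (Q ^ n) a‖) atTop (𝓝 0)) :
    F = E ∧ Q = P * E := by
  have hFF (a : A) : F (F a) = F a := congrArg (fun L : A →L[ℂ] A => L a) h.isIdempotent
  have hrange (x : (F : A →ₗ[ℂ] A).range) : F x = x := by
    obtain ⟨_, a, rfl⟩ := x
    exact hFF a
  have hcongr {a b : A} (hab : F a = F b) : Q a = Q b := by
    rw [h.eq_comp, h.eq_comp]
    exact congrArg (fun x => ((α x : _) : A)) (Subtype.ext hab)
  obtain ⟨h1, h2⟩ := CPDynamics.eq_of_asymptotic hUtop hE hidem hFF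
    (fun x => by rw [h.eq_comp]; exact hrange _) (fun x => hcongr (hFF x)) (fun x hx => by
      rw [h.eq_comp]
      have hn := h.isometric.norm_apply ((F : A →ₗ[ℂ] A).rangeRestrict x)
      refine hn.trans ?_
      change ‖F x‖ = ‖x‖
      rw [hx]) hlim
  exact ⟨h1, ContinuousLinearMap.ext h2⟩

end Quasiautomorphisms

end CPDynamics

theorem theorem4p1 {A : Type*} [NonUnitalCStarAlgebra A] [PartialOrder A] [StarOrderedRing A]
    (P : A →L[ℂ] A) (hP : CPDynamics.IsCPContraction P) (hfin : CPDynamics.IsLocallyFinite P) :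
    ∃ Q : A →L[ℂ] A,
      (CPDynamics.IsQuasiautomorphism Q ∧
        ∀ a : A, Tendsto (fun n : ℕ => ‖(P ^ n) a - (Q ^ n) a‖) atTop (𝓝 0)) ∧
      (∀ Q' : A →L[ℂ] A, CPDynamics.IsQuasiautomorphism Q' →
        (∀ a : A, Tendsto (fun n : ℕ => ‖(P ^ n) a - (Q' ^ n) a‖) atTop (𝓝 0)) → Q' = Q) ∧
      ∀ (E : A →L[ℂ] A) (α : (E : A →ₗ[ℂ] A).range →ₗ[ℂ] (E : A →ₗ[ℂ] A).range),
        CPDynamics.IsFactorization Q E α →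
          (∀ F : A →L[ℂ] A,
            (F ∈ CPDynamics.strongClusterPoints P ∧ IsIdempotentElem F) ↔ F = E) ∧
          (∀ x : (E : A →ₗ[ℂ] A).range, (α x : A) = P (x : A)) ∧
          (E : A →ₗ[ℂ] A).range =
            (Submodule.span ℂ {a : A | CPDynamics.IsMaximalEigenvector P a}).topologicalClosure := by
  have hP1 := hP.norm_le_one
  obtain ⟨U, hUtop, hU⟩ := CPDynamics.exists_additively_idempotent_ultrafilter
  obtain ⟨E, hE⟩ := CPDynamics.exists_pointwise_ultralimit hP1 hfin U
  have hidem := CPDynamics.limit_idempotent hP1 hU hE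
  obtain ⟨α₀, hα₀⟩ := CPDynamics.exists_isFactorization hP hfin hUtop hE hidem
  have hlim (a : A) : Tendsto (fun n : ℕ => ‖(P ^ n) a - ((P * E) ^ n) a‖) atTop (𝓝 0) := by
    have hpow (n : ℕ) : ((P * E) ^ (n + 1)) a = (P ^ (n + 1)) (E a) := by
      induction n with
      | zero => simp
      | succ n ih =>
        rw [CPDynamics.pow_succ_apply', ih, mul_apply_eq_comp,
          CPDynamics.limit_pow_comm hE, hidem, ← CPDynamics.pow_succ_apply']
    refine (CPDynamics.tendsto_norm_pow_apply_zero hP1 hE (x := a - E a)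
      (by rw [map_sub, hidem, sub_self])).congr' ?_
    -- The identity `(P * E) ^ n = P ^ n * E` may fail at `n = 0`.
    filter_upwards [eventually_ge_atTop 1] with n hn
    obtain ⟨m, rfl⟩ := Nat.exists_eq_add_of_le' hn
    rw [hpow, map_sub]
  refine ⟨P * E, ⟨⟨hP.comp hα₀.isCPContraction, E, α₀, hα₀⟩, hlim⟩, ?_, ?_⟩
  · rintro Q' ⟨-, F, α, hF⟩ hQ'
    exact (hF.eq_of_asymptotic hUtop hE hidem hQ').2
  · intro F α hF
    obtain rfl := (hF.eq_of_asymptotic hUtop hE hidem hlim).1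
    refine ⟨fun G => ⟨?_, ?_⟩, fun x => ?_, ?_⟩
    · rintro ⟨hG, hGG⟩
      obtain ⟨V, hVtop, hV⟩ := CPDynamics.mem_strongClusterPoints_iff.mp hG
      exact CPDynamics.idempotent_limit_unique hP1 hUtop hE hidem hVtop hV
        fun a => congrArg (fun L : A →L[ℂ] A => L a) hGG
    · rintro rfl
      exact ⟨CPDynamics.mem_strongClusterPoints_iff.mpr ⟨U, hUtop, hE⟩, hF.isIdempotent⟩
    · obtain ⟨_, a, rfl⟩ := x
      exact (hF.eq_comp a).symm
    · exact CPDynamics.range_limit_eq_closure_span hP1 hfin hUtop hE hidem
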